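/- Let $A_1,A_2,A_3$ and $B_1,B_2,B_3$ be operators on $\mathbb{C}^d$ with $0\le A_j\le \mathbb{1}$ and $0\le B_k\le \mathbb{1}$, so that $\{A_j,\mathbb{1}-A_j\}$ and $\{B_k,\mathbb{1}-B_k\}$ are two-outcome measurements of Alice and of Bob. For a pure state $|\Psi\rangle\in\mathbb{C}^d\otimes\mathbb{C}^d$ put $\langle A_jB_k\rangle=\langle\Psi|A_j\otimes B_k|\Psi\rangle$, $\langle A_j\rangle=\langle\Psi|A_j\otimes\mathbb{1}|\Psi\rangle$, $\langle B_k\rangle=\langle\Psi|\mathbb{1}\otimes B_k|\Psi\rangle$ and $$\langle I_{3322}\rangle=-\langle A_2\rangle-\langle B_1\rangle-2\langle B_2\rangle+\langle A_1B_1\rangle+\langle A_1B_2\rangle+\langle A_2B_1\rangle+\langle A_2B_2\rangle-\langle A_1B_3\rangle+\langle A_2B_3\rangle-\langle A_3B_1\rangle+\langle A_3B_2\rangle .$$ Let $|\Psi_d\rangle=\frac{1}{\sqrt d}\sum_{i=1}^{d}|i\rangle\otimes|i\rangle$ be the maximally entangled state of dimension $d$. 1. For every dimension $d$ and all such measurements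 of Alice and Bob on $|\Psi_d\rangle$, $\langle I_{3322}\rangle\le\frac14$. 2. For $d=2$ there are such measurements on $|\Psi_2\rangle$ with $\langle I_{3322}\rangle=\frac14$. 3. There are a finite dimension $d$, a unit vector $|\Psi\rangle\in\mathbb{C}^d\otimes\mathbb{C}^d$ and such measurements on it with $\langle I_{3322}\rangle>\frac14$. Hence the maximally entangled state, of whatever dimension, is not an optimal resource for $I_{3322}$. -/

import Mathlib

open scoped Matrix Kronecker ComplexOrder

noncomputable section

namespace Bell

/-- The operator attached to the first outcome of a two-outcome measurement `{E, 1 - E}` on `ℂ^d`: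
both `E` and `1 - E` are positive semidefinite. Projective measurements are a special case. -/
def IsEffect {d : ℕ} (E : Matrix (Fin d) (Fin d) ℂ) : Prop :=
  E.PosSemidef ∧ (1 - E).PosSemidef

/-- A pure state of two `d`-dimensional systems: a unit vector of `ℂ^d ⊗ ℂ^d`,
given by its coordinates in the product basis. -/
def IsState {d : ℕ} (ψ : Fin d × Fin d → ℂ) : Prop :=
  star ψ ⬝ᵥ ψ = 1

/-- The maximally entangled state `(1 / √d) ∑ i, |i⟩ ⊗ |i⟩` of `ℂ^d ⊗ ℂ^d`
(a unit vector whenever `0 < d`; for `d = 0` the space is zero). -/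
def maxEntangled (d : ℕ) : Fin d × Fin d → ℂ :=
  fun p => if p.1 = p.2 then ((1 / √(d : ℝ) : ℝ) : ℂ) else 0

/-- The expectation `⟨ψ| A ⊗ B |ψ⟩`. It is a real number when `A` and `B` are Hermitian. -/
def expect {d : ℕ} (ψ : Fin d × Fin d → ℂ) (A B : Matrix (Fin d) (Fin d) ℂ) : ℝ :=
  (star ψ ⬝ᵥ ((A ⊗ₖ B) *ᵥ ψ)).re

/-- The value of the `I₃₃₂₂` Bell expression. The operators `A₁, A₂, A₃` of Alice and
`B₁, B₂, B₃` of Bob are `A 0, A 1, A 2` and `B 0, B 1, B 2`. -/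
def I3322 {d : ℕ} (ψ : Fin d × Fin d → ℂ) (A B : Fin 3 → Matrix (Fin d) (Fin d) ℂ) : ℝ :=
  - expect ψ (A 1) 1 - expect ψ 1 (B 0) - 2 * expect ψ 1 (B 1)
    + expect ψ (A 0) (B 0) + expect ψ (A 0) (B 1)
    + expect ψ (A 1) (B 0) + expect ψ (A 1) (B 1)
    - expect ψ (A 0) (B 2) + expect ψ (A 1) (B 2)
    - expect ψ (A 2) (B 0) + expect ψ (A 2) (B 1)

end Bell

end

/-!
Write `C = A₁ + A₂ - 1`, `S = A₁ - A₂`, `D = B₁ + B₂ - 1`, `T = B₁ - B₂`. The Bell expression is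
`⟨C D⟩ + ⟨C⟩ / 2 - ⟨D⟩ / 2 - 1 + ⟨S (1 - 2 B₃)⟩ / 2 + ⟨(1 - 2 A₃) T⟩ / 2` (`I3322_eq`).

*Upper bound.* On the maximally entangled state expectations are normalised traces, the operators
of Bob being transposed. The expression is affine in each effect, so `A₁, A₂, B₁, B₂` may be taken
to be projections (`exists_isProj_trace_le`). Then `C ^ 2 + S ^ 2 = 1` and `C S + S C = 0`, whence
in an eigenbasis of `C` with eigenvalues `c i` the term with `B₃` is at most
`∑ √(1 - c i ^ 2) / 2`, and the nonzero eigenvalues in `(-1, 1)` come in pairs `c, -c`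
(`IsProj.exists_spectral`). Because of the pairing, `tr C / 2 = ∑ φ (c i)` for *every* odd `φ` with
`φ 1 = 1 / 2`. With the same for `D`, the expression is at most an average, over the doubly
stochastic matrix of squared overlaps of the two eigenbases, of
`x y + φ x - φ y - 1 + (√(1 - x ^ 2) + √(1 - y ^ 2)) / 2`. With `φ x = x / 2` this exceeds `1 / 4`
somewhere; the function `potential` is a choice of `φ` for which it never does
(`add_potential_sub_le`).

*Lower bounds.* Conversely, pairs of projections are built from blocks of size at most two
(`JordanPair`). On a state `∑ a i |i⟩ ⊗ |i⟩` the Bell value becomes a quadratic form in `a`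
(`JordanPair.I3322_measurements`). The same block at angle `30°` for both parties gives exactly
`1 / 4` for `d = 2`. To exceed it, the blocks of Bob are shifted by one index against those of
Alice, which forms a chain of length `18`, and the Schmidt coefficients decay towards one end of
the chain; all data are rational up to normalisation.
-/

noncomputable section

namespace Bell

open Matrix

variable {d : ℕ}

/-! ### The scalar inequality -/

/-- An odd function on `[-1, 1]`: the cubic `(2 / 7) (9 / 4 x - x ^ 3)`, critical at the points
`x = ± √3 / 2` where equality holds in `add_potential_sub_le`, with jumps to the values `± 1 / 2` at
the endpoints. Its values at `± 1` are forced by `IsProj.exists_spectral`; inside, oddness is all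
that is required, and the coefficient `2 / 7` lies in the narrow range that makes that inequality
true. -/
def potential (x : ℝ) : ℝ :=
  if x = 1 then 1 / 2 else if x = -1 then -1 / 2 else 9 / 14 * x - 2 / 7 * x ^ 3

lemma potential_one : potential 1 = 1 / 2 := by simp [potential]

lemma potential_neg (x : ℝ) : potential (-x) = -potential x := by
  unfold potential
  rcases eq_or_ne x 1 with rfl | h1
  · norm_num
  rcases eq_or_ne x (-1) with rfl | h2
  · norm_num
  rw [if_neg (by contrapose! h2; linarith), if_neg (by contrapose! h1; linarith), if_neg h1,
    if_neg h2]
  ring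

/-- For `x = m + δ / 2` and `y = m - δ / 2`, `w = 3 / 4 - m ^ 2 - δ ^ 2 / 4`, this is the polynomial
bound for the increments of the cubic `potential`, up to a nonnegative multiple of `(m * δ) ^ 2`. -/
lemma cubic_potential_poly {w δ : ℝ} (hw : w ≤ 3 / 4 - δ ^ 2 / 4) (hδ : |δ| ≤ 2) :
    0 ≤ 2 / 3 * w ^ 2 - 8 / 27 * w ^ 3 + δ ^ 2 / 2 - 6 / 7 * (δ * w) - δ ^ 3 / 7 := by
  obtain ⟨h1, h2⟩ := abs_le.1 hδ
  rcases le_total w 0 with hw0 | hw0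
  · have h3 : 0 ≤ w ^ 2 * (-w) := mul_nonneg (sq_nonneg _) (by linarith)
    rcases le_total δ 0 with hd | hd
    · have : 0 ≤ δ ^ 2 * (-δ) := mul_nonneg (sq_nonneg _) (by linarith)
      nlinarith [sq_nonneg (w - 9 / 14 * δ), sq_nonneg δ]
    · have : 0 ≤ δ ^ 2 * (2 - δ) := mul_nonneg (sq_nonneg _) (by linarith)
      nlinarith [mul_nonneg hd (neg_nonneg.2 hw0), sq_nonneg δ, sq_nonneg w]
  · have h3 : 0 ≤ w ^ 2 * (3 / 4 - δ ^ 2 / 4 - w) := mul_nonneg (sq_nonneg _) (by linarith)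
    rcases le_total δ 0 with hd | hd
    · have : 0 ≤ δ ^ 2 * (-δ) := mul_nonneg (sq_nonneg _) (by linarith)
      have : 0 ≤ w * (-δ) := mul_nonneg hw0 (by linarith)
      nlinarith [sq_nonneg δ, sq_nonneg w, sq_nonneg (w * δ)]
    · suffices h : 0 ≤ (4 / 9 + 2 / 27 * δ ^ 2) * w ^ 2 - 6 / 7 * δ * w
          + δ ^ 2 / 2 * (1 - 2 / 7 * δ) by nlinarith
      rcases le_total δ 1 with hd1 | hd1
      · -- The discriminant in `w` is nonpositive.
        set a := 4 / 9 + 2 / 27 * δ ^ 2 with ha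
        have hapos : 0 < a := by positivity
        have key : 9 / 49 ≤ a * (1 / 2 * (1 - 2 / 7 * δ)) := by
          rw [ha]
          nlinarith [mul_nonneg hd (sub_nonneg.2 hd1),
            mul_nonneg (mul_nonneg hd (sub_nonneg.2 hd1)) hd]
        have : 0 ≤ a * (a * w ^ 2 - 6 / 7 * δ * w + δ ^ 2 / 2 * (1 - 2 / 7 * δ)) := by
          nlinarith [sq_nonneg (a * w - 3 / 7 * δ), mul_le_mul_of_nonneg_left key (sq_nonneg δ)]
        exact nonneg_of_mul_nonneg_right this hapos
      · have hb : 0 ≤ 3 / 4 - δ ^ 2 / 4 - w := by linarith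
        nlinarith [mul_nonneg hw0 hb, mul_nonneg hb (by linarith : 0 ≤ δ - 1), sq_nonneg (w * δ),
          sq_nonneg (w - 1/2), sq_nonneg (δ - 1), mul_nonneg hb hb]

/-- A polynomial lower bound for `5 / 8 - x ^ 2 / 2 - s / 2 = (s - 1 / 2) ^ 2 / 2` on the upper unit
half-circle, exact at `s = 1 / 2` and at `s = 1`. -/
lemma half_sq_ge {x s : ℝ} (hs : 0 ≤ s) (h : x ^ 2 + s ^ 2 = 1) :
    (x ^ 2 - 3 / 4) ^ 2 * (2 / 9 + 4 / 27 * x ^ 2) ≤ 5 / 8 - x ^ 2 / 2 - s / 2 := by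
  have h1 : x ^ 2 = 1 - s ^ 2 := by linarith
  have hs1 : s ≤ 1 := by nlinarith
  rw [h1]
  have : 0 ≤ (s - 1 / 2) ^ 2 * (1 / 2 - (s + 1 / 2) ^ 2 * (2 / 9 + 4 / 27 * (1 - s ^ 2))) := by
    apply mul_nonneg (sq_nonneg _)
    nlinarith [mul_nonneg hs (sub_nonneg.2 hs1), mul_nonneg (mul_nonneg hs hs) (sub_nonneg.2 hs1),
      mul_nonneg (mul_nonneg hs hs) (sq_nonneg (1 - s)), sq_nonneg (1 - s)]
  nlinarith

lemma cubic_potential_le {x y s t : ℝ} (hs : 0 ≤ s) (ht : 0 ≤ t)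
    (hx : x ^ 2 + s ^ 2 = 1) (hy : y ^ 2 + t ^ 2 = 1) :
    x * y + (9 / 14 * x - 2 / 7 * x ^ 3) - (9 / 14 * y - 2 / 7 * y ^ 3) - 1 + s / 2 + t / 2
      ≤ 1 / 4 := by
  have h1 := half_sq_ge hs hx
  have h2 := half_sq_ge ht hy
  have hx1 : |x| ≤ 1 := abs_le_one_iff_mul_self_le_one.2 (by nlinarith [sq_nonneg s])
  have hy1 : |y| ≤ 1 := abs_le_one_iff_mul_self_le_one.2 (by nlinarith [sq_nonneg t])
  have hd : |x - y| ≤ 2 := (abs_sub x y).trans (by linarith)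
  have hw : 3 / 4 - x ^ 2 / 2 - y ^ 2 / 2 ≤ 3 / 4 - (x - y) ^ 2 / 4 := by
    nlinarith [sq_nonneg (x + y)]
  have h3 := cubic_potential_poly hw hd
  have hw' : 0 ≤ (2 / 3 - 8 / 9 * (3 / 4 - x ^ 2 / 2 - y ^ 2 / 2)) *
      ((x + y) / 2 * (x - y)) ^ 2 :=
    mul_nonneg (by nlinarith [sq_nonneg x, sq_nonneg y]) (sq_nonneg _)
  linarith

lemma endpoint_potential_le {y t : ℝ} (hy : y ^ 2 + t ^ 2 = 1) :
    y + 1 / 2 - (9 / 14 * y - 2 / 7 * y ^ 3) - 1 + t / 2 ≤ 1 / 4 := by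
  have hy1 : |y| ≤ 1 := abs_le_one_iff_mul_self_le_one.2 (by nlinarith [sq_nonneg t])
  obtain ⟨h1, h2⟩ := abs_le.1 hy1
  -- Tangent of the square root near `t ^ 2 = 1 - y ^ 2` at the critical `y ≈ 0.907`.
  have ht : t ≤ (t ^ 2 / (21 / 50) + 21 / 50) / 2 := by nlinarith [sq_nonneg (t - 21 / 50)]
  have ht2 : t ^ 2 = 1 - y ^ 2 := by linarith
  rw [ht2] at ht
  nlinarith [mul_nonneg (by linarith : 0 ≤ y + 1) (sq_nonneg (y - 907 / 1000))]

/-- The scalar inequality behind the bound `1 / 4`: it is what the spectral decompositions of the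
two parties reduce the Bell expression to. Equality holds at `x = y = ± √3 / 2`, `s = t = 1 / 2`. -/
theorem add_potential_sub_le {x y s t : ℝ} (hs : 0 ≤ s) (ht : 0 ≤ t)
    (hx : x ^ 2 + s ^ 2 = 1) (hy : y ^ 2 + t ^ 2 = 1) :
    x * y + potential x - potential y - 1 + s / 2 + t / 2 ≤ 1 / 4 := by
  have hI := cubic_potential_le hs ht hx hy
  have hx0 : (x = 1 ∨ x = -1) → s = 0 := by rintro (rfl | rfl) <;> nlinarith
  have hy0 : (y = 1 ∨ y = -1) → t = 0 := by rintro (rfl | rfl) <;> nlinarith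
  have ex := endpoint_potential_le hy
  -- The inequality is invariant under `(x, y) ↦ (-y, -x)`.
  have ey := endpoint_potential_le (y := -x) (t := s) (by rw [neg_sq]; exact hx)
  unfold potential
  rcases eq_or_ne x 1 with rfl | x1
  · have s0 := hx0 (.inl rfl)
    subst s0
    rcases eq_or_ne y 1 with rfl | y1
    · have t0 := hy0 (.inl rfl)
      subst t0
      norm_num
    rcases eq_or_ne y (-1) with rfl | y2
    · have t0 := hy0 (.inr rfl)
      subst t0
      norm_num
    rw [if_pos rfl, if_neg y1, if_neg y2]
    linarith
  rcases eq_or_ne x (-1) with rfl | x2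
  · have s0 := hx0 (.inr rfl)
    subst s0
    rw [if_neg x1, if_pos rfl]
    rcases eq_or_ne y 1 with rfl | y1
    · have t0 := hy0 (.inl rfl)
      subst t0
      norm_num
    rcases eq_or_ne y (-1) with rfl | y2
    · have t0 := hy0 (.inr rfl)
      subst t0
      norm_num
    rw [if_neg y1, if_neg y2]
    linarith
  rw [if_neg x1, if_neg x2]
  rcases eq_or_ne y 1 with rfl | y1
  · have t0 := hy0 (.inl rfl)
    subst t0
    rw [if_pos rfl]
    linarith
  rcases eq_or_ne y (-1) with rfl | y2
  · have t0 := hy0 (.inr rfl)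
    subst t0
    rw [if_neg y1, if_pos rfl]
    linarith
  rw [if_neg y1, if_neg y2]
  linarith

/-! ### Expectations -/

lemma expect_add_left (ψ : Fin d × Fin d → ℂ) (A A' B : Matrix (Fin d) (Fin d) ℂ) :
    expect ψ (A + A') B = expect ψ A B + expect ψ A' B := by
  simp [expect, add_kronecker, add_mulVec, dotProduct_add]

lemma expect_add_right (ψ : Fin d × Fin d → ℂ) (A B B' : Matrix (Fin d) (Fin d) ℂ) :
    expect ψ A (B + B') = expect ψ A B + expect ψ A B' := by
  simp [expect, kronecker_add, add_mulVec, dotProduct_add]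

lemma expect_sub_left (ψ : Fin d × Fin d → ℂ) (A A' B : Matrix (Fin d) (Fin d) ℂ) :
    expect ψ (A - A') B = expect ψ A B - expect ψ A' B := by
  rw [eq_sub_iff_add_eq, ← expect_add_left, sub_add_cancel]

lemma expect_sub_right (ψ : Fin d × Fin d → ℂ) (A B B' : Matrix (Fin d) (Fin d) ℂ) :
    expect ψ A (B - B') = expect ψ A B - expect ψ A B' := by
  rw [eq_sub_iff_add_eq, ← expect_add_right, sub_add_cancel]

/-- The Bell expression in terms of the sums and differences of the first two measurements
of each party. -/
lemma I3322_eq (ψ : Fin d × Fin d → ℂ) (A B : Fin 3 → Matrix (Fin d) (Fin d) ℂ) :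
    I3322 ψ A B = expect ψ (A 0 + A 1 - 1) (B 0 + B 1 - 1) + expect ψ (A 0 + A 1 - 1) 1 / 2
      - expect ψ 1 (B 0 + B 1 - 1) / 2 - expect ψ 1 1
      + expect ψ (A 0 - A 1) (1 - (B 2 + B 2)) / 2
      + expect ψ (1 - (A 2 + A 2)) (B 0 - B 1) / 2 := by
  simp only [I3322, expect_add_left, expect_add_right, expect_sub_left, expect_sub_right]
  ring

/-- The vector `∑ i, a i |i⟩ ⊗ |i⟩`. -/
def schmidtState (a : Fin d → ℝ) : Fin d × Fin d → ℂ :=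
  fun p => if p.1 = p.2 then (a p.1 : ℂ) else 0

lemma maxEntangled_eq_schmidtState (d : ℕ) :
    maxEntangled d = schmidtState fun _ => 1 / √(d : ℝ) := rfl

lemma expect_schmidtState (a : Fin d → ℝ) (A B : Matrix (Fin d) (Fin d) ℂ) :
    expect (schmidtState a) A B = ∑ i, ∑ j, a i * a j * (A i j * B i j).re := by
  simp only [expect, dotProduct, mulVec, schmidtState, Fintype.sum_prod_type, kroneckerMap_apply,
    Pi.star_apply, apply_ite star, star_zero, mul_ite, mul_zero, ite_mul, zero_mul,
    Finset.sum_ite_eq, Finset.mem_univ, if_true]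
  simp only [Finset.mul_sum, Complex.re_sum]
  refine Finset.sum_congr rfl fun i _ => Finset.sum_congr rfl fun j _ => ?_
  rw [← Complex.re_ofReal_mul]
  congr 1
  simp
  ring

lemma isState_schmidtState {a : Fin d → ℝ} (h : ∑ i, a i ^ 2 = 1) :
    IsState (schmidtState a) := by
  simp only [IsState, dotProduct, schmidtState, Fintype.sum_prod_type,
    Pi.star_apply, apply_ite star, star_zero, mul_ite, mul_zero, ite_mul, zero_mul,
    Finset.sum_ite_eq, Finset.mem_univ, if_true]
  have := congrArg (fun x : ℝ => (x : ℂ)) h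
  push_cast at this
  rw [← this]
  refine Finset.sum_congr rfl fun i _ => ?_
  simp [pow_two]

/-- The maximally entangled state turns expectations into normalised traces. -/
lemma expect_maxEntangled (A B : Matrix (Fin d) (Fin d) ℂ) :
    expect (maxEntangled d) A B = (A * Bᵀ).trace.re / d := by
  rw [maxEntangled_eq_schmidtState, expect_schmidtState]
  simp only [trace, diag_apply, mul_apply, transpose_apply, Complex.re_sum, Finset.sum_div]
  refine Finset.sum_congr rfl fun i _ => Finset.sum_congr rfl fun j _ => ?_
  rw [div_mul_div_comm, Real.mul_self_sqrt (Nat.cast_nonneg d)]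
  ring

/-! ### Projections and effects -/

/-- An orthogonal projection. -/
def IsProj (P : Matrix (Fin d) (Fin d) ℂ) : Prop := P.IsHermitian ∧ P * P = P

lemma IsProj.isEffect {P : Matrix (Fin d) (Fin d) ℂ} (h : IsProj P) : IsEffect P := by
  have h1 := posSemidef_conjTranspose_mul_self P
  have h2 := posSemidef_conjTranspose_mul_self (1 - P)
  have h3 : (1 - P)ᴴ * (1 - P) = 1 - P := by
    rw [conjTranspose_sub, conjTranspose_one, h.1.eq, sub_mul, mul_sub, mul_sub, h.2]
    simp
  rw [h.1.eq, h.2] at h1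
  rw [h3] at h2
  exact ⟨h1, h2⟩

lemma IsEffect.transpose {E : Matrix (Fin d) (Fin d) ℂ} (h : IsEffect E) : IsEffect Eᵀ := by
  refine ⟨h.1.transpose, ?_⟩
  simpa using h.2.transpose

lemma IsEffect.conj {E V : Matrix (Fin d) (Fin d) ℂ} (h : IsEffect E) (hV : star V * V = 1) :
    IsEffect (star V * E * V) := by
  refine ⟨h.1.conjTranspose_mul_mul_same _, ?_⟩
  have := h.2.conjTranspose_mul_mul_same V
  rwa [mul_sub, sub_mul, mul_one, ← star_eq_conjTranspose, hV] at this

lemma trace_conj {V : Matrix (Fin d) (Fin d) ℂ} (h : V * star V = 1)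
    (M N : Matrix (Fin d) (Fin d) ℂ) :
    ((star V * M * V) * (star V * N * V)).trace = (M * N).trace := by
  calc _ = (star V * (M * (V * star V) * N * V)).trace := by simp only [Matrix.mul_assoc]
    _ = _ := by rw [h, trace_mul_comm, Matrix.mul_one, Matrix.mul_assoc _ _ (star _), h,
      Matrix.mul_one]

lemma exists_unitary_diagonal {M : Matrix (Fin d) (Fin d) ℂ} (hM : M.IsHermitian) :
    ∃ (V : Matrix (Fin d) (Fin d) ℂ) (m : Fin d → ℝ), star V * V = 1 ∧ V * star V = 1 ∧
      star V * M * V = diagonal fun i => (m i : ℂ) := by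
  refine ⟨hM.eigenvectorUnitary, hM.eigenvalues, Unitary.coe_star_mul_self _,
    Unitary.coe_mul_star_self _, ?_⟩
  have := hM.conjStarAlgAut_star_eigenvectorUnitary
  rw [Unitary.conjStarAlgAut_star_apply] at this
  exact this

/-- A linear functional on effects is maximised at a projection: the spectral projection of `M` onto
the positive eigenvalues. -/
lemma exists_isProj_trace_le {M : Matrix (Fin d) (Fin d) ℂ} (hM : M.IsHermitian) :
    ∃ P, IsProj P ∧ ∀ E, IsEffect E → (E * M).trace.re ≤ (P * M).trace.re := by
  obtain ⟨V, m, hs, hs', hU⟩ := exists_unitary_diagonal hM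
  set p : Fin d → ℂ := fun i => if 0 < m i then 1 else 0 with hp
  have hconj : star V * (V * diagonal p * star V) * V = diagonal p := by
    simp only [Matrix.mul_assoc, hs, Matrix.mul_one]
    rw [← Matrix.mul_assoc, hs, Matrix.one_mul]
  refine ⟨V * diagonal p * star V, ⟨?_, ?_⟩, fun E hE => ?_⟩
  · refine isHermitian_mul_mul_conjTranspose _ ?_
    rw [isHermitian_diagonal_iff]
    intro i
    by_cases h : 0 < m i <;> simp [hp, h, IsSelfAdjoint]
  · have : diagonal p * diagonal p = diagonal p := by
      rw [diagonal_mul_diagonal]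
      congr 1
      ext i
      simp [hp]
    calc _ = V * (diagonal p * (star V * V) * diagonal p) * star V := by
          simp only [Matrix.mul_assoc]
      _ = _ := by rw [hs, Matrix.mul_one, this]
  · rw [← trace_conj hs' E M, ← trace_conj hs' _ M, hconj, hU]
    have h := hE.conj hs
    simp only [trace, diag_apply, mul_diagonal, Complex.re_sum, diagonal_apply_eq]
    refine Finset.sum_le_sum fun i _ => ?_
    rw [Complex.re_mul_ofReal, Complex.re_mul_ofReal]
    have h1 := (Complex.le_def.1 (h.1.diag_nonneg (i := i))).1
    have h2 := (Complex.le_def.1 (h.2.diag_nonneg (i := i))).1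
    simp only [Matrix.sub_apply, one_apply_eq, Complex.sub_re, Complex.one_re, Complex.zero_re]
      at h1 h2
    by_cases h0 : 0 < m i
    · simp only [hp, h0, if_true, Complex.one_re, one_mul]
      nlinarith
    · simp only [hp, h0, if_false, Complex.zero_re, zero_mul]
      nlinarith

/-! ### The bound on the maximally entangled state -/

lemma mul_self_diag_of_isHermitian {M : Matrix (Fin d) (Fin d) ℂ} (hM : M.IsHermitian) (i : Fin d) :
    (M * M) i i = ((∑ j, ‖M i j‖ ^ 2 : ℝ) : ℂ) := by
  rw [mul_apply]
  push_cast
  refine Finset.sum_congr rfl fun j _ => ?_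
  rw [← hM.apply j i, Complex.star_def, Complex.mul_conj, Complex.normSq_eq_norm_sq]
  push_cast
  rfl

/-- The observable `1 - 2 E` of an effect is a contraction. -/
lemma IsEffect.sum_norm_sq_le {E : Matrix (Fin d) (Fin d) ℂ} (h : IsEffect E) (i : Fin d) :
    ∑ j, ‖(1 - (E + E)) i j‖ ^ 2 ≤ 1 := by
  have hE := h.1.isHermitian
  have h1 : (E * (1 - E) * E + (1 - E) * E * (1 - E)).PosSemidef := by
    have a := h.2.conjTranspose_mul_mul_same E
    have b := h.1.conjTranspose_mul_mul_same (1 - E)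
    rw [hE.eq] at a
    rw [h.2.isHermitian.eq] at b
    exact a.add b
  have hG : (1 - (E + E)).IsHermitian := isHermitian_one.sub (hE.add hE)
  have h2 : (1 - (E + E)) * (1 - (E + E)) =
      1 - (4 : ℂ) • (E * (1 - E) * E + (1 - E) * E * (1 - E)) := by
    have : (4 : ℂ) • (E * (1 - E) * E + (1 - E) * E * (1 - E)) =
        (4 : ℕ) • (E * (1 - E) * E + (1 - E) * E * (1 - E)) := by
      rw [← Nat.cast_smul_eq_nsmul ℂ]; norm_num
    rw [this]
    noncomm_ring
  have h3 := congrArg Complex.re (congrFun (congrFun h2 i) i)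
  have h4 := (Complex.le_def.1 (h1.diag_nonneg (i := i))).1
  rw [mul_self_diag_of_isHermitian hG, Complex.ofReal_re, Matrix.sub_apply, one_apply_eq,
    Matrix.smul_apply, Complex.sub_re, Complex.one_re, smul_eq_mul] at h3
  rw [h3, show (4 : ℂ) = ((4 : ℝ) : ℂ) by norm_num, Complex.re_ofReal_mul]
  rw [Complex.zero_re] at h4
  linarith

/-- Joint spectral data of two projections `P`, `Q`. In an eigenbasis of `P + Q - 1` with
eigenvalues `c i`, the anticommuting operator `P - Q` pairs `c` with `-c` away from `c = ± 1`, so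
odd functions vanishing at the endpoints have trace zero; and its `i`-th row has length
`√(1 - c i ^ 2)`. -/
theorem IsProj.exists_spectral {P Q : Matrix (Fin d) (Fin d) ℂ} (hP : IsProj P) (hQ : IsProj Q) :
    ∃ (V : Matrix (Fin d) (Fin d) ℂ) (c : Fin d → ℝ), star V * V = 1 ∧ V * star V = 1 ∧
      star V * (P + Q - 1) * V = diagonal (fun i => (c i : ℂ)) ∧ (∀ i, c i ^ 2 ≤ 1) ∧
      (∀ h : ℝ → ℝ, (∀ x, h (-x) = -h x) → h 1 = 0 → ∑ i, h (c i) = 0) ∧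
      ∀ E, IsEffect E → ((P - Q) * (1 - (E + E))).trace.re ≤ ∑ i, √(1 - c i ^ 2) := by
  have hC : (P + Q - 1).IsHermitian := (hP.1.add hQ.1).sub isHermitian_one
  have hS : (P - Q).IsHermitian := hP.1.sub hQ.1
  obtain ⟨V, c, hs, hs', hV⟩ := exists_unitary_diagonal hC
  have hsq : (P + Q - 1) * (P + Q - 1) + (P - Q) * (P - Q) = 1 := by
    simp only [add_mul, mul_add, sub_mul, mul_sub, hP.2, hQ.2, mul_one, one_mul]
    abel
  have hanti : (P + Q - 1) * (P - Q) + (P - Q) * (P + Q - 1) = 0 := by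
    simp only [add_mul, mul_add, sub_mul, mul_sub, hP.2, hQ.2, mul_one, one_mul]
    abel
  have hmul : ∀ M N, star V * (M * N) * V = (star V * M * V) * (star V * N * V) := by
    intro M N
    calc _ = star V * (M * (1 * N)) * V := by rw [Matrix.one_mul]
      _ = _ := by rw [← hs']; simp only [Matrix.mul_assoc]
  set S := star V * (P - Q) * V with hSdef
  have hSh : S.IsHermitian := isHermitian_conjTranspose_mul_mul V hS
  have hsq' : diagonal (fun i => (c i : ℂ)) * diagonal (fun i => (c i : ℂ)) + S * S = 1 := by
    rw [← hV, hSdef, ← hmul, ← hmul, ← add_mul, ← mul_add, hsq, mul_one, hs]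
  have hanti' : diagonal (fun i => (c i : ℂ)) * S + S * diagonal (fun i => (c i : ℂ)) = 0 := by
    rw [← hV, hSdef, ← hmul, ← hmul, ← add_mul, ← mul_add, hanti, mul_zero, zero_mul]
  have hrow : ∀ i, ∑ j, ‖S i j‖ ^ 2 = 1 - c i ^ 2 := by
    intro i
    have := congrFun (congrFun hsq' i) i
    rw [Matrix.add_apply, mul_self_diag_of_isHermitian hSh, diagonal_mul_diagonal,
      diagonal_apply_eq, one_apply_eq] at this
    have h2 : c i * c i + ∑ j, ‖S i j‖ ^ 2 = 1 := by exact_mod_cast this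
    linarith
  have hpair : ∀ i j, S i j ≠ 0 → c j = -c i := by
    intro i j hij
    have := congrFun (congrFun hanti' i) j
    rw [Matrix.add_apply, diagonal_mul, mul_diagonal, Matrix.zero_apply] at this
    have h2 : ((c i + c j : ℝ) : ℂ) * S i j = 0 := by push_cast; linear_combination this
    have h3 : c i + c j = 0 := by
      simpa [hij, ← Complex.ofReal_add, -Complex.ofReal_add] using h2
    linarith
  refine ⟨V, c, hs, hs', hV, fun i => ?_, fun h hodd h1 => ?_, fun E hE => ?_⟩
  · have := hrow i
    have : 0 ≤ ∑ j, ‖S i j‖ ^ 2 := by positivity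
    linarith
  · -- `h (c i) = k i * (1 - c i ^ 2)`, and the double sum of `k i * ‖S i j‖ ^ 2` is antisymmetric.
    set k : Fin d → ℝ := fun i => h (c i) / (1 - c i ^ 2) with hk
    have hkh : ∀ i, h (c i) = k i * ∑ j, ‖S i j‖ ^ 2 := by
      intro i
      rw [hrow, hk]
      rcases eq_or_ne (1 - c i ^ 2) 0 with h0 | h0
      · rw [h0, mul_zero]
        rcases (sq_eq_sq_iff_eq_or_eq_neg.1 (by linarith : c i ^ 2 = 1 ^ 2)) with h2 | h2
        · rw [h2, h1]
        · rw [h2, hodd, h1, neg_zero]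
      · field_simp
    have hkanti : ∀ i j, k i * ‖S i j‖ ^ 2 = -(k j * ‖S j i‖ ^ 2) := by
      intro i j
      have hsymm : ‖S j i‖ = ‖S i j‖ := by rw [← hSh.apply j i, norm_star]
      rcases eq_or_ne (S i j) 0 with h0 | h0
      · rw [hsymm, h0]; simp
      · rw [hsymm, hk]
        simp only [hpair i j h0, hodd, neg_sq]
        ring
    have : ∑ i, h (c i) = -∑ i, h (c i) := by
      calc ∑ i, h (c i) = ∑ i, ∑ j, k i * ‖S i j‖ ^ 2 := by simp only [hkh, Finset.mul_sum]
        _ = ∑ i, ∑ j, -(k j * ‖S j i‖ ^ 2) := by simp only [← hkanti]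
        _ = -∑ i, h (c i) := by
          rw [Finset.sum_comm]
          simp only [hkh, Finset.mul_sum, Finset.sum_neg_distrib]
    linarith
  · have hE' := hE.conj hs
    have hG : star V * (1 - (E + E)) * V = 1 - (star V * E * V + star V * E * V) := by
      rw [mul_sub, sub_mul, mul_one, hs, mul_add, add_mul]
    have hGh : (1 - (star V * E * V + star V * E * V)).IsHermitian :=
      isHermitian_one.sub (hE'.1.isHermitian.add hE'.1.isHermitian)
    rw [← trace_conj hs', ← hSdef, hG]
    set G := 1 - (star V * E * V + star V * E * V) with hGdef
    rw [trace, Complex.re_sum]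
    refine Finset.sum_le_sum fun i _ => ?_
    rw [diag_apply, mul_apply, Complex.re_sum]
    calc ∑ j, (S i j * G j i).re ≤ ∑ j, ‖S i j‖ * ‖G i j‖ := by
          refine Finset.sum_le_sum fun j _ => (Complex.re_le_norm _).trans ?_
          rw [norm_mul, ← hGh.apply j i, norm_star]
      _ ≤ √(∑ j, ‖S i j‖ ^ 2) * √(∑ j, ‖G i j‖ ^ 2) := Real.sum_mul_le_sqrt_mul_sqrt _ _ _
      _ ≤ √(∑ j, ‖S i j‖ ^ 2) * 1 := by
          gcongr
          exact Real.sqrt_le_one.2 (hE'.sum_norm_sq_le i)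
      _ = √(1 - c i ^ 2) := by rw [hrow, mul_one]

/-- In eigenbases of `P + Q - 1` and `R + T - 1` the left-hand side is at most an average, over the
doubly stochastic matrix `‖X i j‖ ^ 2` of squared overlaps, of the scalar expression in
`add_potential_sub_le`; replacing `c / 2` by `potential c` does not change the traces. -/
theorem trace_le_of_isProj {P Q R T E F : Matrix (Fin d) (Fin d) ℂ} (hP : IsProj P)
    (hQ : IsProj Q) (hR : IsProj R) (hT : IsProj T) (hE : IsEffect E) (hF : IsEffect F) :
    ((P + Q - 1) * (R + T - 1)).trace.re + (P + Q - 1).trace.re / 2 - (R + T - 1).trace.re / 2 - d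
      + ((P - Q) * (1 - (F + F))).trace.re / 2 + ((R - T) * (1 - (E + E))).trace.re / 2
      ≤ d / 4 := by
  obtain ⟨V, c, hV, hV', hC, hc, hcodd, hcF⟩ := hP.exists_spectral hQ
  obtain ⟨W, e, hW, hW', hD, he, heodd, heE⟩ := hR.exists_spectral hT
  set X := star V * W with hX
  have hXX : X * star X = 1 := by
    rw [hX, star_mul, star_star, Matrix.mul_assoc, ← Matrix.mul_assoc W, hW', Matrix.one_mul, hV]
  have hXX' : star X * X = 1 := by
    rw [hX, star_mul, star_star, Matrix.mul_assoc, ← Matrix.mul_assoc V, hV', Matrix.one_mul, hW]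
  have hrow : ∀ i, ∑ j, ‖X i j‖ ^ 2 = 1 := by
    intro i
    have := congrFun (congrFun hXX i) i
    rw [mul_apply, one_apply_eq] at this
    have h2 : ((∑ j, ‖X i j‖ ^ 2 : ℝ) : ℂ) = 1 := by
      rw [← this]
      push_cast
      refine Finset.sum_congr rfl fun j _ => ?_
      rw [star_apply, Complex.star_def, Complex.mul_conj, Complex.normSq_eq_norm_sq]
      push_cast
      rfl
    exact_mod_cast h2
  have hcol : ∀ j, ∑ i, ‖X i j‖ ^ 2 = 1 := by
    intro j
    have := congrFun (congrFun hXX' j) j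
    rw [mul_apply, one_apply_eq] at this
    have h2 : ((∑ i, ‖X i j‖ ^ 2 : ℝ) : ℂ) = 1 := by
      rw [← this]
      push_cast
      refine Finset.sum_congr rfl fun i _ => ?_
      rw [star_apply, Complex.star_def, mul_comm, Complex.mul_conj, Complex.normSq_eq_norm_sq]
      push_cast
      rfl
    exact_mod_cast h2
  have htr : ∀ (U M : Matrix (Fin d) (Fin d) ℂ) (m : Fin d → ℝ), U * star U = 1 →
      star U * M * U = diagonal (fun i => (m i : ℂ)) → M.trace.re = ∑ i, m i := by
    intro U M m hU hM
    have h1 := congrArg trace hM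
    rw [trace_mul_comm, ← Matrix.mul_assoc, hU, Matrix.one_mul, trace_diagonal] at h1
    rw [h1, Complex.re_sum]
    rfl
  have hprod : ((P + Q - 1) * (R + T - 1)).trace.re = ∑ i, ∑ j, ‖X i j‖ ^ 2 * (c i * e j) := by
    have h1 : star V * (R + T - 1) * V = X * diagonal (fun i => (e i : ℂ)) * star X := by
      rw [← hD, hX, star_mul, star_star]
      calc _ = star V * ((W * star W) * (R + T - 1) * (W * star W)) * V := by
            rw [hW', Matrix.one_mul, Matrix.mul_one]
        _ = _ := by simp only [Matrix.mul_assoc]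
    rw [← trace_conj hV', hC, h1, trace, Complex.re_sum]
    refine Finset.sum_congr rfl fun i _ => ?_
    rw [diag_apply, diagonal_mul, mul_apply, Complex.re_ofReal_mul, Complex.re_sum, Finset.mul_sum]
    refine Finset.sum_congr rfl fun j _ => ?_
    rw [mul_diagonal, star_apply, Complex.star_def, mul_right_comm, Complex.mul_conj,
      Complex.normSq_eq_norm_sq, ← Complex.ofReal_mul, Complex.ofReal_re]
    ring
  have hφc : (P + Q - 1).trace.re / 2 = ∑ i, potential (c i) := by
    rw [htr V _ c hV' hC]
    have := hcodd (fun x => potential x - x / 2) (fun x => by rw [potential_neg]; ring)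
      (by rw [potential_one]; norm_num)
    rw [Finset.sum_sub_distrib, ← Finset.sum_div] at this
    linarith
  have hφe : (R + T - 1).trace.re / 2 = ∑ j, potential (e j) := by
    rw [htr W _ e hW' hD]
    have := heodd (fun x => potential x - x / 2) (fun x => by rw [potential_neg]; ring)
      (by rw [potential_one]; norm_num)
    rw [Finset.sum_sub_distrib, ← Finset.sum_div] at this
    linarith
  have hi : ∀ f : Fin d → ℝ, ∑ i, f i = ∑ i, ∑ j, ‖X i j‖ ^ 2 * f i := by
    intro f
    simp only [← Finset.sum_mul, hrow, one_mul]
  have hj : ∀ f : Fin d → ℝ, ∑ j, f j = ∑ i, ∑ j, ‖X i j‖ ^ 2 * f j := by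
    intro f
    rw [Finset.sum_comm]
    simp only [← Finset.sum_mul, hcol, one_mul]
  have hd : ∀ r : ℝ, (d : ℝ) * r = ∑ i, ∑ j, ‖X i j‖ ^ 2 * r := by
    intro r
    rw [← hi]
    simp
  have key : ∑ i, ∑ j, ‖X i j‖ ^ 2 * (c i * e j + potential (c i) - potential (e j) - 1
      + √(1 - c i ^ 2) / 2 + √(1 - e j ^ 2) / 2) ≤ (d : ℝ) * (1 / 4) := by
    rw [hd]
    refine Finset.sum_le_sum fun i _ => Finset.sum_le_sum fun j _ => ?_
    refine mul_le_mul_of_nonneg_left ?_ (sq_nonneg _)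
    refine add_potential_sub_le (Real.sqrt_nonneg _) (Real.sqrt_nonneg _) ?_ ?_
    · rw [Real.sq_sqrt (by linarith [hc i])]; ring
    · rw [Real.sq_sqrt (by linarith [he j])]; ring
  have hF' := hcF F hF
  have hE' := heE E hE
  simp only [mul_add, mul_sub, Finset.sum_add_distrib, Finset.sum_sub_distrib, ← hi, ← hj,
    Finset.sum_const, Finset.card_univ, Fintype.card_fin, nsmul_one] at key
  rw [← hprod, ← Finset.sum_div, ← Finset.sum_div] at key
  rw [hφc, hφe]
  linarith

/-- The bound for arbitrary effects: the expression is affine in each of them, so the first two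
measurements of each party can be replaced by projections one after the other. -/
theorem trace_le_of_isEffect {A₀ A₁ A₂ B₀ B₁ B₂ : Matrix (Fin d) (Fin d) ℂ} (hA₀ : IsEffect A₀)
    (hA₁ : IsEffect A₁) (hA₂ : IsEffect A₂) (hB₀ : IsEffect B₀) (hB₁ : IsEffect B₁)
    (hB₂ : IsEffect B₂) :
    ((A₀ + A₁ - 1) * (B₀ + B₁ - 1)).trace.re + (A₀ + A₁ - 1).trace.re / 2
      - (B₀ + B₁ - 1).trace.re / 2 - d + ((A₀ - A₁) * (1 - (B₂ + B₂))).trace.re / 2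
      + ((B₀ - B₁) * (1 - (A₂ + A₂))).trace.re / 2 ≤ d / 4 := by
  obtain ⟨P, hP, hPle⟩ := exists_isProj_trace_le
    (hB₀.1.isHermitian.add hB₁.1.isHermitian |>.sub hB₂.1.isHermitian)
  obtain ⟨Q, hQ, hQle⟩ := exists_isProj_trace_le
    (hB₀.1.isHermitian.add hB₁.1.isHermitian |>.add hB₂.1.isHermitian |>.sub isHermitian_one)
  obtain ⟨R, hR, hRle⟩ := exists_isProj_trace_le
    (hP.1.add hQ.1 |>.sub hA₂.1.isHermitian |>.sub isHermitian_one)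
  obtain ⟨T, hT, hTle⟩ := exists_isProj_trace_le
    (hP.1.add hQ.1 |>.add hA₂.1.isHermitian |>.sub (isHermitian_one.add isHermitian_one))
  have h1 := hPle _ hA₀
  have h2 := hQle _ hA₁
  have h3 := hRle _ hB₀
  have h4 := hTle _ hB₁
  have h5 := trace_le_of_isProj hP hQ hR hT hA₂ hB₂
  simp only [add_mul, mul_add, sub_mul, mul_sub, trace_add, trace_sub, Complex.add_re,
    Complex.sub_re, mul_one, one_mul, trace_mul_comm B₀ P, trace_mul_comm B₀ Q,
    trace_mul_comm B₁ P, trace_mul_comm B₁ Q, trace_mul_comm R P, trace_mul_comm R Q,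
    trace_mul_comm T P, trace_mul_comm T Q] at h1 h2 h3 h4 h5 ⊢
  linarith

theorem I3322_maxEntangled_le (A B : Fin 3 → Matrix (Fin d) (Fin d) ℂ)
    (hA : ∀ j, IsEffect (A j)) (hB : ∀ k, IsEffect (B k)) :
    I3322 (maxEntangled d) A B ≤ 1 / 4 := by
  rcases Nat.eq_zero_or_pos d with rfl | hd
  · -- On the zero space every expectation vanishes.
    simp [I3322, expect]
  have hd' : (0 : ℝ) < d := by exact_mod_cast hd
  have h := trace_le_of_isEffect (hA 0) (hA 1) (hA 2) (hB 0).transpose (hB 1).transpose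
    (hB 2).transpose
  rw [I3322_eq]
  simp only [expect_maxEntangled, transpose_add, transpose_sub, transpose_one, mul_one, one_mul,
    trace_one, Fintype.card_fin, Complex.natCast_re]
  rw [trace_mul_comm ((B 0)ᵀ - (B 1)ᵀ)] at h
  rw [← mul_le_mul_iff_right₀ hd']
  refine le_trans (le_of_eq ?_) (h.trans_eq (by ring))
  field_simp

/-! ### Explicit measurements -/

lemma isProj_half {M : Matrix (Fin d) (Fin d) ℂ} (hM : M.IsHermitian)
    (h : M * M = 1) :
    IsProj ((1 / 2 : ℂ) • (1 + M)) := by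
  constructor
  · have : IsSelfAdjoint (1 / 2 : ℂ) := by simp [IsSelfAdjoint]
    rw [IsHermitian, conjTranspose_smul, (isHermitian_one.add hM).eq, this.star_eq]
  · rw [smul_mul_smul_comm, add_mul, mul_add, mul_add, h]
    simp only [mul_one, one_mul]
    module

/-- A pair of projections in Jordan normal form: their sum is `1 + diag c`, and their difference
maps the `i`-th basis vector to `s i` times the `partner i`-th one. An index may be its own partner; it
is then a one-dimensional block. The last two fields say that the operators with these matrices
anticommute and that their squares add up to `1`. -/
structure JordanPair (d : ℕ) where
  partner : Fin d → Fin d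
  c : Fin d → ℝ
  s : Fin d → ℝ
  partner_partner : ∀ i, partner (partner i) = i
  s_partner : ∀ i, s (partner i) = s i
  anti : ∀ i, s i * (c i + c (partner i)) = 0
  sq_add_sq : ∀ i, c i ^ 2 + s i ^ 2 = 1

namespace JordanPair

/-- The matrix sending the `i`-th basis vector to `w i` times its partner. -/
def hop (J : JordanPair d) (w : Fin d → ℝ) : Matrix (Fin d) (Fin d) ℂ :=
  of fun i j => if j = J.partner i then (w i : ℂ) else 0

variable (J : JordanPair d)

lemma eq_partner_iff {i j : Fin d} : i = J.partner j ↔ j = J.partner i :=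
  ⟨fun h => by rw [h, J.partner_partner], fun h => by rw [h, J.partner_partner]⟩

lemma isHermitian_hop {w : Fin d → ℝ} (hw : ∀ i, w (J.partner i) = w i) :
    (J.hop w).IsHermitian := by
  ext i j
  simp only [conjTranspose_apply, hop, of_apply, J.eq_partner_iff (i := i)]
  split_ifs with h
  · simp [h, hw]
  · simp

lemma hop_mul_hop {w : Fin d → ℝ} (hw : ∀ i, w (J.partner i) = w i) :
    J.hop w * J.hop w = diagonal fun i => ((w i ^ 2 : ℝ) : ℂ) := by
  ext i j
  simp only [mul_apply, hop, of_apply, ite_mul, zero_mul, Finset.sum_ite_eq', Finset.mem_univ,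
    if_true, J.partner_partner, hw, diagonal_apply, eq_comm (a := j)]
  split_ifs
  · push_cast; ring
  · simp

lemma diagonal_mul_hop_add :
    diagonal (fun i => (J.c i : ℂ)) * J.hop J.s +
      J.hop J.s * diagonal (fun i => (J.c i : ℂ)) = 0 := by
  ext i j
  rw [Matrix.add_apply, diagonal_mul, mul_diagonal, Matrix.zero_apply]
  simp only [hop, of_apply]
  split_ifs with h
  · subst h
    have := J.anti i
    have h2 : ((J.s i * (J.c i + J.c (J.partner i)) : ℝ) : ℂ) = 0 := by rw [this]; simp
    push_cast at h2
    linear_combination h2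
  · simp

/-- The two projections (for `ε = 1` and `ε = -1`) of a Jordan pair. -/
def proj (ε : ℂ) : Matrix (Fin d) (Fin d) ℂ :=
  (1 / 2 : ℂ) • (1 + diagonal (fun i => (J.c i : ℂ)) + ε • J.hop J.s)

/-- The effect whose observable `1 - 2 E` exchanges partners. -/
def swapEffect : Matrix (Fin d) (Fin d) ℂ := (1 / 2 : ℂ) • (1 - J.hop 1)

lemma isProj_proj {ε : ℝ} (hε : ε ^ 2 = 1) : IsProj (J.proj ε) := by
  have h2 : (ε : ℂ) * ε = 1 := by rw [← pow_two]; exact_mod_cast hε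
  rw [proj, add_assoc]
  refine isProj_half (IsHermitian.add ?_ ?_) ?_
  · rw [isHermitian_diagonal_iff]
    intro i
    simp [IsSelfAdjoint]
  · rw [IsHermitian, conjTranspose_smul, (J.isHermitian_hop J.s_partner).eq]
    simp
  · rw [add_mul, mul_add, mul_add, smul_mul_smul_comm, h2, one_smul, J.hop_mul_hop J.s_partner,
      smul_mul_assoc, mul_smul_comm, diagonal_mul_diagonal]
    have h3 := J.diagonal_mul_hop_add
    rw [← eq_neg_iff_add_eq_zero] at h3
    rw [h3, smul_neg, add_assoc, neg_add_cancel_left, diagonal_add, ← diagonal_one]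
    congr 1
    ext i
    have := J.sq_add_sq i
    rw [← pow_two]
    exact_mod_cast this

lemma isEffect_swapEffect : IsEffect J.swapEffect := by
  rw [swapEffect, sub_eq_add_neg]
  refine (isProj_half (J.isHermitian_hop fun _ => rfl).neg ?_).isEffect
  rw [neg_mul_neg, J.hop_mul_hop fun _ => rfl]
  simp

/-- Measurements `0` and `1` are a Jordan pair; measurement `2` exchanges the partners in the
other party's pair. -/
def measurements (J K : JordanPair d) : Fin 3 → Matrix (Fin d) (Fin d) ℂ :=
  ![J.proj 1, J.proj (-1), K.swapEffect]

lemma isEffect_measurements (J K : JordanPair d) (j : Fin 3) : IsEffect (J.measurements K j) := by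
  fin_cases j
  · have h := (J.isProj_proj (ε := 1) (by norm_num)).isEffect
    rwa [Complex.ofReal_one] at h
  · have h := (J.isProj_proj (ε := -1) (by norm_num)).isEffect
    rwa [Complex.ofReal_neg, Complex.ofReal_one] at h
  · exact K.isEffect_swapEffect

lemma expect_diagonal_diagonal (a c e : Fin d → ℝ) :
    expect (schmidtState a) (diagonal fun i => (c i : ℂ)) (diagonal fun i => (e i : ℂ)) =
      ∑ i, a i ^ 2 * (c i * e i) := by
  rw [expect_schmidtState]
  refine Finset.sum_congr rfl fun i _ => ?_
  rw [Finset.sum_eq_single i (fun j _ h => by simp [diagonal_apply_ne' _ h]) (by simp)]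
  rw [diagonal_apply_eq, diagonal_apply_eq, ← Complex.ofReal_mul, Complex.ofReal_re, pow_two]

lemma expect_hop_hop (a v w : Fin d → ℝ) :
    expect (schmidtState a) (J.hop v) (J.hop w) =
      ∑ i, a i * a (J.partner i) * (v i * w i) := by
  rw [expect_schmidtState]
  refine Finset.sum_congr rfl fun i _ => ?_
  rw [Finset.sum_eq_single (J.partner i) (fun j _ h => by simp [hop, h]) (by simp)]
  simp [hop]

/-- The Bell value is a quadratic form in the Schmidt coefficients that couples each index to its
two partners only. -/
lemma I3322_measurements (J K : JordanPair d) (a : Fin d → ℝ) :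
    I3322 (schmidtState a) (J.measurements K) (K.measurements J) =
      ∑ i, (a i ^ 2 * (J.c i * K.c i + (J.c i - K.c i) / 2 - 1)
        + a i * a (J.partner i) * J.s i / 2 + a i * a (K.partner i) * K.s i / 2) := by
  have hsum : ∀ L : JordanPair d, L.proj 1 + L.proj (-1) - 1 = diagonal fun i => (L.c i : ℂ) := by
    intro L; rw [proj, proj]; module
  have hdiff : ∀ L : JordanPair d, L.proj 1 - L.proj (-1) = L.hop L.s := by
    intro L; rw [proj, proj]; module
  have hswap : ∀ L : JordanPair d, 1 - (L.swapEffect + L.swapEffect) = L.hop 1 := by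
    intro L; rw [swapEffect]; module
  have hone : (1 : Matrix (Fin d) (Fin d) ℂ) = diagonal fun _ => ((1 : ℝ) : ℂ) := by simp
  rw [I3322_eq]
  simp only [measurements, cons_val_zero, cons_val_one, cons_val]
  rw [hsum, hsum, hdiff, hdiff, hswap, hswap, hone]
  simp only [expect_diagonal_diagonal, expect_hop_hop, Finset.sum_div, ← Finset.sum_add_distrib,
    ← Finset.sum_sub_distrib]
  refine Finset.sum_congr rfl fun i _ => ?_
  simp only [Pi.one_apply]
  ring

end JordanPair

/-- The rank-one projections of a qubit whose Bloch vectors make the angle `30°` with the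
`z`-axis. -/
def qubitPair : JordanPair 2 where
  partner := ![1, 0]
  c := ![√3 / 2, -(√3 / 2)]
  s := fun _ => 1 / 2
  partner_partner := by decide
  s_partner _ := rfl
  anti i := by fin_cases i <;> simp
  sq_add_sq i := by
    have h : √3 ^ 2 = 3 := Real.sq_sqrt (by norm_num)
    fin_cases i
    · simp only [Fin.zero_eta, cons_val_zero, div_pow, h]; norm_num
    · simp only [Fin.mk_one, cons_val_one, cons_val_zero, neg_sq, div_pow, h]; norm_num

lemma I3322_qubitPair :
    I3322 (maxEntangled 2) (qubitPair.measurements qubitPair)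
      (qubitPair.measurements qubitPair) = 1 / 4 := by
  have h3 : √(3 : ℝ) * √3 = 3 := Real.mul_self_sqrt (by norm_num)
  have h2 : (1 / √(2 : ℝ)) * (1 / √2) = 1 / 2 := by
    rw [div_mul_div_comm, Real.mul_self_sqrt (by norm_num)]; norm_num
  rw [maxEntangled_eq_schmidtState, JordanPair.I3322_measurements, Fin.sum_univ_two]
  simp only [Nat.cast_ofNat, pow_two, h2, qubitPair, cons_val_zero, cons_val_one]
  linear_combination h3 / 4

/-- Alice's first two measurements in dimension `18`: partners `(0 1) (2 3) ⋯ (16 17)`.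
The angles are Pythagorean approximations to those found by numerical optimisation; in the bulk they
stay close to the `30°` of `qubitPair`. -/
def alicePair : JordanPair 18 where
  partner := ![1, 0, 3, 2, 5, 4, 7, 6, 9, 8, 11, 10, 13, 12, 15, 14, 17, 16]
  c := ![3 / 5, -3 / 5, 15 / 17, -15 / 17, 15 / 17, -15 / 17, 15 / 17, -15 / 17, 15 / 17, -15 / 17,
    15 / 17, -15 / 17, 15 / 17, -15 / 17, 15 / 17, -15 / 17, 12 / 13, -12 / 13]
  s := ![4 / 5, 4 / 5, 8 / 17, 8 / 17, 8 / 17, 8 / 17, 8 / 17, 8 / 17, 8 / 17, 8 / 17,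
    8 / 17, 8 / 17, 8 / 17, 8 / 17, 8 / 17, 8 / 17, 5 / 13, 5 / 13]
  partner_partner := by decide
  s_partner i := by fin_cases i <;> rfl
  anti i := by fin_cases i <;> simp <;> norm_num
  sq_add_sq i := by fin_cases i <;> norm_num

/-- Bob's first two measurements in dimension `18`: partners `(1 2) (3 4) ⋯ (15 16)`, shifted by one
against Alice's, so that together they link all indices to a chain. The ends `0` and `17` are their
own partners. -/
def bobPair : JordanPair 18 where
  partner := ![0, 2, 1, 4, 3, 6, 5, 8, 7, 10, 9, 12, 11, 14, 13, 16, 15, 17]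
  c := ![0, -4 / 5, 4 / 5, -15 / 17, 15 / 17, -15 / 17, 15 / 17, -15 / 17, 15 / 17, -15 / 17,
    15 / 17, -15 / 17, 15 / 17, -15 / 17, 15 / 17, -12 / 13, 12 / 13, -1]
  s := ![1, 3 / 5, 3 / 5, 8 / 17, 8 / 17, 8 / 17, 8 / 17, 8 / 17, 8 / 17, 8 / 17,
    8 / 17, 8 / 17, 8 / 17, 8 / 17, 8 / 17, 5 / 13, 5 / 13, 0]
  partner_partner := by decide
  s_partner i := by fin_cases i <;> rfl
  anti i := by fin_cases i <;> simp <;> norm_num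
  sq_add_sq i := by fin_cases i <;> norm_num

/-- Schmidt coefficients before normalisation: integer approximations to the leading eigenvector of
the quadratic form in `JordanPair.I3322_measurements`. -/
def chainWeight : Fin 18 → ℝ := ![15, 17, 18, 17, 15, 14, 13, 12, 11, 10, 9, 8, 7, 6, 5, 4, 3, 2]

lemma sum_chainWeight_sq : ∑ i, chainWeight i ^ 2 = 2366 := by
  simp [chainWeight, Fin.sum_univ_succ]
  norm_num

lemma lt_sum_chain :
    (2366 : ℝ) / 4 < ∑ i, (chainWeight i ^ 2 * (alicePair.c i * bobPair.c i
        + (alicePair.c i - bobPair.c i) / 2 - 1)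
      + chainWeight i * chainWeight (alicePair.partner i) * alicePair.s i / 2
      + chainWeight i * chainWeight (bobPair.partner i) * bobPair.s i / 2) := by
  simp only [chainWeight, alicePair, bobPair, Fin.sum_univ_succ]
  simp
  norm_num

lemma isState_chain : IsState (schmidtState fun i => chainWeight i / √2366) := by
  refine isState_schmidtState ?_
  simp only [div_pow, ← Finset.sum_div, sum_chainWeight_sq]
  rw [Real.sq_sqrt (by norm_num), div_self (by norm_num)]

lemma lt_I3322_chain :
    1 / 4 < I3322 (schmidtState fun i => chainWeight i / √2366) (alicePair.measurements bobPair)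
      (bobPair.measurements alicePair) := by
  have h : √(2366 : ℝ) * √2366 = 2366 := Real.mul_self_sqrt (by norm_num)
  have hlt := lt_sum_chain
  rw [JordanPair.I3322_measurements]
  simp only [div_pow, pow_two (√(2366 : ℝ)), div_mul_div_comm, h]
  rw [← mul_lt_mul_iff_right₀ (by norm_num : (0 : ℝ) < 2366), Finset.mul_sum]
  refine lt_of_eq_of_lt (by ring) (hlt.trans_eq (Finset.sum_congr rfl fun i _ => ?_))
  ring

end Bell

end

theorem theorem1 :
    (∀ (d : ℕ) (A B : Fin 3 → Matrix (Fin d) (Fin d) ℂ),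
      (∀ j, Bell.IsEffect (A j)) → (∀ k, Bell.IsEffect (B k)) →
        Bell.I3322 (Bell.maxEntangled d) A B ≤ 1 / 4) ∧
    (∃ A B : Fin 3 → Matrix (Fin 2) (Fin 2) ℂ,
      (∀ j, Bell.IsEffect (A j)) ∧ (∀ k, Bell.IsEffect (B k)) ∧
        Bell.I3322 (Bell.maxEntangled 2) A B = 1 / 4) ∧
    (∃ (d : ℕ) (ψ : Fin d × Fin d → ℂ) (A B : Fin 3 → Matrix (Fin d) (Fin d) ℂ),
      Bell.IsState ψ ∧ (∀ j, Bell.IsEffect (A j)) ∧ (∀ k, Bell.IsEffect (B k)) ∧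
        1 / 4 < Bell.I3322 ψ A B) := by
  refine ⟨fun d A B hA hB => Bell.I3322_maxEntangled_le A B hA hB,
    ⟨_, _, Bell.qubitPair.isEffect_measurements _, Bell.qubitPair.isEffect_measurements _,
      Bell.I3322_qubitPair⟩,
    ⟨18, _, _, _, Bell.isState_chain, Bell.alicePair.isEffect_measurements _,
      Bell.bobPair.isEffect_measurements _, Bell.lt_I3322_chain⟩⟩
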